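/- Let $\mathcal S$ be a measurable space of states, $(\mathcal A,d_{\mathcal A})$ a metric space of actions with its Borel $\sigma$-algebra, and $p_{\mathcal D}$ a probability measure on $\mathcal S\times\mathcal A$ (the expert state-action distribution) with state marginal $p_{\mathcal D,S}$ and regular conditional distributions $p_{\mathcal D}(\cdot\mid s)$, $s\in\mathcal S$. Suppose that for every $s\in\mathcal S$ there are an integer $\mathsf K(s)\ge 1$ and sets $C_1(s),\dots,C_{\mathsf K(s)}(s)\subseteq\mathcal A$ (the modes) with $$\operatorname{supp}p_{\mathcal D}(\cdot\mid s)\subseteq\bigcup_{k=1}^{\mathsf K(s)}C_k(s),\qquad \min_{k\ne k'}\ \inf_{a\in C_k(s),\,b\in C_{k'}(s)}d_{\mathcal A}(a,b)>0 ,$$ and that $\mathsf K$ and the mode assignment $g(a,s)=\sum_{k=1}^{\mathsf K(s)}k\,\mathbf 1_{\{a\in C_k(s)\}}$ are measurable. Let $q_\phi(\cdot\mid a,s)$ be a probability kernel from $\mathcal S\times\mathcal A$ to $\mathbb R^{d}$ (the posterior encoder) and $f_\theta:\mathbb R^{d}\times\mathcal S\to\mathcal A$ a measurable function (the deterministic decoder).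 Let $(S,A)\sim p_{\mathcal D}$, let $Z\sim q_\phi(\cdot\mid A,S)$ given $(S,A)$, let $M=g(A,S)$ be the mode label, and let $$\rho(s)=\Pr\bigl(f_\theta(Z,s)\notin C_M(s)\,\big|\,S=s\bigr)$$ be the mode-recovery error, computed with $A\sim p_{\mathcal D}(\cdot\mid s)$ and $Z\sim q_\phi(\cdot\mid A,s)$. If $\rho(s)=0$ for $p_{\mathcal D,S}$-almost every $s$ and, for $p_{\mathcal D,S}$-almost every $s$, the conditional law of $M$ given $S=s$ is uniform on $\{1,\dots,\mathsf K(s)\}$, then $$I(A;Z\mid S)\ \ge\ \mathbb E_{S\sim p_{\mathcal D,S}}\bigl[\log \mathsf K(S)\bigr],$$ where $I(A;Z\mid S)\in[0,\infty]$ is the conditional mutual information in nats, that is, the Kullback-Leibler divergence of the law of $(S,A,Z)$ from the law with the same marginal of $S$ and the same conditional laws of $A$ and of $Z$ given $S$ but with $A$ and $Z$ conditionally independent given $S$. (Either side may be $+\infty$.) -/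

import Mathlib

open MeasureTheory ProbabilityTheory InformationTheory
open scoped ENNReal

noncomputable section

variable {S A : Type*}

/-- The mode-assignment function `g(a, s) = ∑_{k=1}^{K(s)} k · 1{a ∈ C_k(s)}`. The mode sets at the
state `s` are `C s 1, …, C s (K s)`; the values `C s k` for other indices `k` are never used. -/
def modeLabel (K : S → ℕ) (C : S → ℕ → Set A) (a : A) (s : S) : ℕ :=
  ∑ k ∈ Finset.Icc 1 (K s), k * (C s k).indicator 1 a

/-- The separation `Δ(s) = min_{k ≠ k'} dist(C_k(s), C_{k'}(s))` of the mode sets at `s`, where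
`dist(B, B') = inf {d(a, b) | a ∈ B, b ∈ B'}` (an infimum over the empty set is `∞`). -/
def modeGap [EDist A] (K : S → ℕ) (C : S → ℕ → Set A) (s : S) : ℝ≥0∞ :=
  ⨅ k ∈ Finset.Icc 1 (K s), ⨅ l ∈ Finset.Icc 1 (K s), ⨅ _ : k ≠ l,
    ⨅ a ∈ C s k, ⨅ b ∈ C s l, edist a b

/-- `C_1(s), …, C_{K(s)}(s)` are the valid mode sets of the conditional action distribution
`πD s = p_D(· | s)`: finitely many, well separated, covering its support. The last two fields say
that `K(S)` and the mode label `M = g(A, S)` are random variables. -/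
structure IsModeFamily [MeasurableSpace S] [MetricSpace A] [MeasurableSpace A]
    (πD : Kernel S A) (K : S → ℕ) (C : S → ℕ → Set A) : Prop where
  one_le : ∀ s, 1 ≤ K s
  support_subset : ∀ s, (πD s).support ⊆ ⋃ k ∈ Finset.Icc 1 (K s), C s k
  gap_pos : ∀ s, 0 < modeGap K C s
  measurable_card : Measurable K
  measurable_label : Measurable fun p : A × S => modeLabel K C p.1 p.2

variable {Z : Type*} [MeasurableSpace S] [MeasurableSpace A] [MeasurableSpace Z]

/-- The conditional mutual information `I(A; Z | S)` (in nats, with values in `[0, ∞]`) of random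
variables with `S ∼ μ` and `(A, Z) | S = s ∼ η s`: the Kullback-Leibler divergence of the law of
`(S, A, Z)` from the law under which `S`, `A | S` and `Z | S` have the same distributions and
`A`, `Z` are conditionally independent given `S`. -/
def condMutualInfo (μ : Measure S) (η : Kernel S (A × Z)) : ℝ≥0∞ :=
  klDiv (μ ⊗ₘ η) (μ ⊗ₘ (η.fst ×ₖ η.snd))

/-- The mode-recovery error `ρ(s) = Pr(f(Z, s) ∉ C_M(s) | S = s)`, `M = g(A, s)`, where given
`S = s` the action is `A ∼ πD s` and the latent is `Z ∼ q (s, A)`. (An action `A` outside all mode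
sets has no demonstrated mode to recover and counts as an error.) -/
def modeError (πD : Kernel S A) (q : Kernel (S × A) Z) (f : Z → S → A)
    (K : S → ℕ) (C : S → ℕ → Set A) (s : S) : ℝ :=
  ((πD ⊗ₖ q) s).real {x : A × Z |
    ¬ (modeLabel K C x.1 s ∈ Finset.Icc 1 (K s) ∧ f x.2 s ∈ C s (modeLabel K C x.1 s))}

end

/-!
Fix a state `s`. Because the mode sets are disjoint, an action lies in `C_m(s)` with `1 ≤ m ≤ K(s)`
exactly when its label is `m` (`mem_iff_modeLabel_eq`). Exact mode recovery therefore says that the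
decoded label `g(f(Z, s), s)` equals the demonstrated label `M = g(A, s)` almost surely. Let `E` be
the event that these two labels agree, with common value in `{1, …, K(s)}`.

* Under the true law of `(S, A, Z)` the event `E` has probability one.
* The decoded label has the same conditional law as `M`, namely the uniform one. So once `A` and `Z`
  are made conditionally independent, `E` has conditional probability `1 / K(s)`
  (`prod_fst_snd_apply_eq_inv`).

By the data processing inequality for the observation `(S, 1_E)`, the conditional mutual information
is at least the divergence between the two laws of that observation. The first has density
`K(S) · 1_E` with respect to the second, so that divergence is the mean of `log K(S)`
(`lintegral_log_le_klDiv_of_restrict_map_eq`). No Fano-type estimate or entropy of `M` enters, and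
an infinite mean needs no separate treatment.
-/

section KullbackLeibler

open Set

variable {X S : Type*} {mX : MeasurableSpace X} {mS : MeasurableSpace S}

/-- Only the inequality is claimed so that no integrability of `log h` is needed: if it fails, the
divergence is `∞`. -/
lemma lintegral_log_le_klDiv_withDensity {ν : Measure X} [IsProbabilityMeasure ν] {h : X → ℝ≥0∞}
    (hh : Measurable h) [IsProbabilityMeasure (ν.withDensity h)]
    (h_one : ∀ᵐ x ∂ν.withDensity h, 1 ≤ (h x).toReal) :
    ∫⁻ x, ENNReal.ofReal (Real.log (h x).toReal) ∂ν.withDensity h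
      ≤ klDiv (ν.withDensity h) ν := by
  by_cases h_int : Integrable (llr (ν.withDensity h) ν) (ν.withDensity h)
  swap
  · simp [klDiv_of_not_integrable h_int]
  have h_ac : ν.withDensity h ≪ ν := withDensity_absolutelyContinuous ν h
  have h_llr : llr (ν.withDensity h) ν =ᵐ[ν.withDensity h] fun x => Real.log (h x).toReal := by
    filter_upwards [h_ac.ae_le (Measure.rnDeriv_withDensity ν hh)] with x hx
    simp [llr, hx]
  rw [klDiv_of_ac_of_integrable h_ac h_int, integral_congr_ae h_llr,
    ofReal_integral_eq_lintegral_ofReal ((integrable_congr h_llr).1 h_int) ?_ |>.symm]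
  · simp
  · filter_upwards [h_one] with x hx using Real.log_nonneg hx

/-- If `P` lives on the event `E`, while under `Q` the event has conditional probability `1 / K`
given the variable `g`, which moreover has the same law under both, then `klDiv P Q` is at least
the mean of `log K`. This is data processing for the observation `(g, 1_E)`, whose law under `P`
has density `K · 1_E` with respect to its law under `Q`. -/
lemma lintegral_log_le_klDiv_of_restrict_map_eq {P Q : Measure X} [IsProbabilityMeasure P]
    [IsProbabilityMeasure Q] {E : Set X} (hE : MeasurableSet E) {g : X → S} (hg : Measurable g)
    {K : S → ℕ} (hK : Measurable K) (hK_one : ∀ s, 1 ≤ K s) (hPE : ∀ᵐ x ∂P, x ∈ E)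
    (hQE : (Q.restrict E).map g = (P.map g).withDensity fun s => (K s : ℝ≥0∞)⁻¹) :
    ∫⁻ s, ENNReal.ofReal (Real.log (K s)) ∂P.map g ≤ klDiv P Q := by
  classical
  have hK' : Measurable fun s => (K s : ℝ≥0∞) := measurable_from_top.comp hK
  let T : X → S × Prop := fun x => (g x, x ∈ E)
  have hT : Measurable T := hg.prodMk (measurable_mem.2 hE)
  have hp : MeasurableSet {y : S × Prop | y.2} := measurableSet_setOfPred.2 measurable_snd
  let h : S × Prop → ℝ≥0∞ := fun y => if y.2 then (K y.1 : ℝ≥0∞) else 0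
  have hh : Measurable h := Measurable.ite hp (hK'.comp measurable_fst) measurable_const
  have hPg : ((Q.restrict E).map g).withDensity (fun s => (K s : ℝ≥0∞)) = P.map g := by
    rw [hQE]
    convert! withDensity_inv_same (μ := P.map g) hK'.inv ?_ ?_ using 2
    · ext s
      simp
    · exact .of_forall fun s => by simp
    · exact .of_forall fun s => by simpa using Nat.one_le_iff_ne_zero.1 (hK_one s)
  have hPT : P.map T = (Q.map T).withDensity h := by
    ext B hB
    -- the slice of `B` over the event `E`
    have hB' : MeasurableSet {s | (s, True) ∈ B} := measurable_prodMk_right hB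
    calc P.map T B = P.map g {s | (s, True) ∈ B} := by
          rw [Measure.map_apply hT hB, Measure.map_apply hg hB']
          refine measure_congr ?_
          filter_upwards [hPE] with x hx
          change ((g x, x ∈ E) ∈ B) = ((g x, True) ∈ B)
          rw [eq_true hx]
      _ = ∫⁻ x in g ⁻¹' {s | (s, True) ∈ B}, (K (g x) : ℝ≥0∞) ∂Q.restrict E := by
          rw [← hPg, withDensity_apply _ hB', setLIntegral_map hB' hK' hg]
      _ = ∫⁻ x in T ⁻¹' B, h (T x) ∂Q := by
          rw [Measure.restrict_restrict (hg hB'), ← lintegral_indicator ((hg hB').inter hE),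
            ← lintegral_indicator (hT hB)]
          refine lintegral_congr fun x => ?_
          by_cases hx : x ∈ E <;> simp [T, h, hx, indicator]
      _ = (Q.map T).withDensity h B := by
          rw [withDensity_apply _ hB, setLIntegral_map hB hh hT]
  have : IsProbabilityMeasure (Q.map T) := Measure.isProbabilityMeasure_map hT.aemeasurable
  have : IsProbabilityMeasure ((Q.map T).withDensity h) :=
    hPT ▸ Measure.isProbabilityMeasure_map hT.aemeasurable
  have h_eq : ∀ᵐ x ∂P, (h (T x)).toReal = K (g x) := by
    filter_upwards [hPE] with x hx
    simp [h, T, hx]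
  calc ∫⁻ s, ENNReal.ofReal (Real.log (K s)) ∂P.map g
      = ∫⁻ y, ENNReal.ofReal (Real.log (h y).toReal) ∂P.map T := by
        rw [lintegral_map (by fun_prop) hg, lintegral_map (by fun_prop) hT]
        refine lintegral_congr_ae ?_
        filter_upwards [h_eq] with x hx
        rw [hx]
    _ ≤ klDiv (P.map T) (Q.map T) := by
        rw [hPT]
        refine lintegral_log_le_klDiv_withDensity hh ?_
        rw [← hPT]
        refine (ae_map_iff hT.aemeasurable (measurableSet_le (by fun_prop) (by fun_prop))).2 ?_
        filter_upwards [h_eq] with x hx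
        rw [hx]
        exact_mod_cast hK_one (g x)
    _ ≤ klDiv P Q := klDiv_map_le P Q hT

end KullbackLeibler

section GuessingProbability

open Set

/-- If two variables `u`, `v` agree almost surely and are uniform on `{1, …, n}`, then their
decoupled copies agree with probability `1 / n`. -/
lemma prod_fst_snd_apply_eq_inv {A Z : Type*} [MeasurableSpace A] [MeasurableSpace Z]
    {η : Measure (A × Z)} [IsProbabilityMeasure η] {u : A → ℕ} {v : Z → ℕ}
    (hu : Measurable u) (hv : Measurable v) {n : ℕ} (h_eq : ∀ᵐ x ∂η, u x.1 = v x.2)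
    (h_unif : η.fst.map u = uniformOn (Icc 1 n)) :
    (η.fst.prod η.snd) {x | u x.1 ∈ Finset.Icc 1 n ∧ v x.2 = u x.1} = (n : ℝ≥0∞)⁻¹ := by
  have h_fst : ∀ m ∈ Finset.Icc 1 n, η.fst.map u {m} = (n : ℝ≥0∞)⁻¹ := fun m hm => by
    rw [h_unif, ← Finset.coe_Icc, ← Finset.coe_singleton, uniformOn_apply_finset,
      Finset.inter_singleton_of_mem hm]
    simp
  have h_snd : ∀ m ∈ Finset.Icc 1 n, η.snd (v ⁻¹' {m}) = (n : ℝ≥0∞)⁻¹ := fun m hm => by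
    rw [← h_fst m hm, Measure.map_apply hu (measurableSet_singleton m),
      Measure.fst_apply (hu (measurableSet_singleton m)),
      Measure.snd_apply (hv (measurableSet_singleton m))]
    refine measure_congr ?_
    filter_upwards [h_eq] with x hx
    change (v x.2 = m) = (u x.1 = m)
    rw [hx]
  have h_mem : ∀ᵐ a ∂η.fst, u a ∈ Finset.Icc 1 n := by
    refine ae_of_ae_map (p := fun m => m ∈ Finset.Icc 1 n) hu.aemeasurable ?_
    rw [h_unif]
    filter_upwards [ae_cond_mem (μ := Measure.count) (measurableSet_Icc (a := 1) (b := n))]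
      with m hm using Finset.mem_Icc.2 hm
  have hE : MeasurableSet {x : A × Z | u x.1 ∈ Finset.Icc 1 n ∧ v x.2 = u x.1} :=
    ((hu.comp measurable_fst) (Finset.measurableSet (Finset.Icc 1 n))).inter
      (measurableSet_eq_fun (hv.comp measurable_snd) (hu.comp measurable_fst))
  rw [Measure.prod_apply hE]
  calc ∫⁻ a, η.snd (Prod.mk a ⁻¹' {x | u x.1 ∈ Finset.Icc 1 n ∧ v x.2 = u x.1}) ∂η.fst
      = ∫⁻ _, (n : ℝ≥0∞)⁻¹ ∂η.fst := by
        refine lintegral_congr_ae ?_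
        filter_upwards [h_mem] with a ha
        rw [← h_snd (u a) ha]
        congr 1
        ext z
        simpa using fun _ => Finset.mem_Icc.1 ha
    _ = (n : ℝ≥0∞)⁻¹ := by simp

end GuessingProbability

section Modes

variable {S A : Type*} {K : S → ℕ} {C : S → ℕ → Set A} {s : S} {a : A} {m : ℕ}

/-- Mode sets at positive distance from each other are disjoint. -/
lemma eq_of_mem_of_modeGap_pos [MetricSpace A] (hgap : 0 < modeGap K C s) {k l : ℕ}
    (hk : k ∈ Finset.Icc 1 (K s)) (hl : l ∈ Finset.Icc 1 (K s)) (hak : a ∈ C s k)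
    (hal : a ∈ C s l) : k = l := by
  by_contra hkl
  refine hgap.not_ge ?_
  unfold modeGap
  exact iInf₂_le_of_le k hk <| iInf₂_le_of_le l hl <| iInf_le_of_le hkl <|
    iInf₂_le_of_le a hak <| iInf₂_le_of_le a hal (edist_self a).le

/-- For separated mode sets the label determines the mode: an action in no mode set has label `0`,
which is not an admissible index. -/
lemma mem_iff_modeLabel_eq [MetricSpace A] (hgap : 0 < modeGap K C s)
    (hm : m ∈ Finset.Icc 1 (K s)) : a ∈ C s m ↔ modeLabel K C a s = m := by
  have key : ∀ k ∈ Finset.Icc 1 (K s), a ∈ C s k → modeLabel K C a s = k := fun k hk hak => by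
    unfold modeLabel
    rw [Finset.sum_eq_single_of_mem k hk]
    · simp [hak]
    · intro l hl hlk
      have hal : a ∉ C s l := fun hal => hlk (eq_of_mem_of_modeGap_pos hgap hl hk hal hak)
      simp [hal]
  refine ⟨key m hm, fun h => ?_⟩
  by_contra ham
  by_cases hex : ∃ k ∈ Finset.Icc 1 (K s), a ∈ C s k
  · obtain ⟨k, hk, hak⟩ := hex
    exact ham (h ▸ (key k hk hak).symm ▸ hak)
  · push Not at hex
    have h0 : modeLabel K C a s = 0 := Finset.sum_eq_zero fun k hk => by simp [hex k hk]
    have := (Finset.mem_Icc.1 hm).1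
    omega

end Modes

theorem corollary1 {S A : Type*} [MeasurableSpace S]
    [MetricSpace A] [MeasurableSpace A] [BorelSpace A] (d : ℕ)
    -- the demonstration law of `(S, A)` and its conditional action distribution given `S = s`
    (pD : Measure (S × A)) [IsProbabilityMeasure pD]
    (πD : Kernel S A) [IsMarkovKernel πD] [pD.IsCondKernel πD]
    -- the valid mode sets
    (K : S → ℕ) (C : S → ℕ → Set A) (hC : IsModeFamily πD K C)
    -- the posterior encoder and the deterministic decoder
    (q : Kernel (S × A) (EuclideanSpace ℝ (Fin d))) [IsMarkovKernel q]
    (f : EuclideanSpace ℝ (Fin d) → S → A) (hf : Measurable (Function.uncurry f))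
    -- exact mode recovery
    (hρ : ∀ᵐ s ∂pD.fst, modeError πD q f K C s = 0)
    -- given `S = s`, the mode label is uniform on `{1, …, K s}`
    (hM : ∀ᵐ s ∂pD.fst,
      (πD s).map (fun a => modeLabel K C a s) = uniformOn (Set.Icc 1 (K s))) :
    ∫⁻ s, ENNReal.ofReal (Real.log (K s)) ∂pD.fst ≤ condMutualInfo pD.fst (πD ⊗ₖ q) := by
  set μ := pD.fst
  set η : Kernel S (A × EuclideanSpace ℝ (Fin d)) := πD ⊗ₖ q
  -- the event that the decoded and the demonstrated action carry the same admissible label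
  let E : Set (S × A × EuclideanSpace ℝ (Fin d)) :=
    {p | modeLabel K C p.2.1 p.1 ∈ Finset.Icc 1 (K p.1) ∧
      modeLabel K C (f p.2.2 p.1) p.1 = modeLabel K C p.2.1 p.1}
  have hu : Measurable fun p : S × A × EuclideanSpace ℝ (Fin d) => modeLabel K C p.2.1 p.1 :=
    hC.measurable_label.comp (measurable_snd.fst.prodMk measurable_fst)
  have hv : Measurable fun p : S × A × EuclideanSpace ℝ (Fin d) =>
      modeLabel K C (f p.2.2 p.1) p.1 :=
    hC.measurable_label.comp
      ((hf.comp (measurable_snd.snd.prodMk measurable_fst)).prodMk measurable_fst)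
  have hE : MeasurableSet E := by
    simp only [E, Finset.mem_Icc]
    exact ((measurableSet_le measurable_const hu).inter
      (measurableSet_le hu (hC.measurable_card.comp measurable_fst))).inter
      (measurableSet_eq_fun hv hu)
  have hηE : ∀ᵐ s ∂μ, ∀ᵐ x ∂η s, (s, x) ∈ E := by
    filter_upwards [hρ] with s hs
    have h0 := (measureReal_eq_zero_iff (measure_ne_top _ _)).1 hs
    filter_upwards [ae_iff.2 h0] with x hx
    exact ⟨hx.1, (mem_iff_modeLabel_eq (hC.gap_pos s) hx.1).1 hx.2⟩
  have hP : (μ ⊗ₘ η).map Prod.fst = μ := Measure.fst_compProd μ η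
  have hPE : ∀ᵐ p ∂μ ⊗ₘ η, p ∈ E := (Measure.ae_compProd_iff hE).2 hηE
  -- given `S = s`, decoupling `A` and `Z` gives `E` the probability `1 / K s`
  have hQE : ((μ ⊗ₘ (η.fst ×ₖ η.snd)).restrict E).map Prod.fst
      = ((μ ⊗ₘ η).map Prod.fst).withDensity fun s => (K s : ℝ≥0∞)⁻¹ := by
    ext B hB
    have hB' : MeasurableSet (Prod.fst ⁻¹' B : Set (S × A × EuclideanSpace ℝ (Fin d))) :=
      measurable_fst hB
    rw [hP, withDensity_apply _ hB, Measure.map_apply measurable_fst hB,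
      Measure.restrict_apply hB', Measure.compProd_apply (hB'.inter hE),
      ← lintegral_indicator hB]
    refine lintegral_congr_ae ?_
    filter_upwards [hηE, hM] with s hs hMs
    by_cases hsB : s ∈ B
    · have h_slice : Prod.mk s ⁻¹' (Prod.fst ⁻¹' B ∩ E) = {x | modeLabel K C x.1 s ∈
          Finset.Icc 1 (K s) ∧ modeLabel K C (f x.2 s) s = modeLabel K C x.1 s} := by
        ext x
        simp [hsB, E]
      rw [h_slice, Set.indicator_of_mem hsB, Kernel.prod_apply, Kernel.fst_apply, Kernel.snd_apply]
      refine prod_fst_snd_apply_eq_inv (η := η s) (u := fun a => modeLabel K C a s)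
        (v := fun z => modeLabel K C (f z s) s)
        (hC.measurable_label.comp measurable_prodMk_right)
        (hC.measurable_label.comp
          ((hf.comp measurable_prodMk_right).prodMk measurable_const)) ?_ ?_
      · filter_upwards [hs] with x hx using hx.2.symm
      · rw [← hMs, Measure.fst, ← Kernel.fst_apply, Kernel.fst_compProd]
    · have h_slice : Prod.mk s ⁻¹' (Prod.fst ⁻¹' B ∩ E) = ∅ := by
        ext x
        simp [hsB]
      simp [h_slice, hsB]
  have := lintegral_log_le_klDiv_of_restrict_map_eq hE measurable_fst hC.measurable_card
    hC.one_le hPE hQE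
  rwa [hP] at this
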